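/- Let $\mathbb{N}$ be the set of positive integers and order $\mathbb{N}\times\mathbb{N}$ by $(i,m)\leqslant(j,n)$ if and only if $i\le j$ and $m\le n$. Let $\mathscr{P\!O}_\infty(\mathbb{N}^2_\leqslant)$ be the monoid of all injective partial maps $\alpha\colon\mathbb{N}\times\mathbb{N}\rightharpoonup\mathbb{N}\times\mathbb{N}$ whose domain and range have finite complement and which are monotone ($x\leqslant y$ implies $(x)\alpha\leqslant(y)\alpha$ for $x,y\in\operatorname{dom}\alpha$), with the composition $x(\alpha\beta)=(x\alpha)\beta$ of partial maps. Let $\textsf{H}^1=\{(j,1):j\in\mathbb{N}\}$ and let $$\mathscr{P\!O}^{+}_\infty(\mathbb{N}^2_\leqslant)=\{\alpha\in\mathscr{P\!O}_\infty(\mathbb{N}^2_\leqslant):(\textsf{H}^1\cap\operatorname{dom}\alpha)\alpha\subseteq\textsf{H}^1\}$$ be the submonoid of orientation-preserving elements. For $\alpha,\beta\in\mathscr{P\!O}_\infty(\mathbb{N}^2_\leqslant)$ write $\alpha\,\sigma\,\beta$ if $\alpha\varepsilon=\beta\varepsilon$ for some idempotent $\varepsilon\in\mathscr{P\!O}_\infty(\mathbb{N}^2_\leqslant)$;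 this is a congruence, and its restriction to $\mathscr{P\!O}^{+}_\infty(\mathbb{N}^2_\leqslant)$ is also denoted by $\sigma$. For each positive integer $n$ let $\gamma_n,\upsilon_n\in\mathscr{P\!O}^{+}_\infty(\mathbb{N}^2_\leqslant)$ be the row shift and the column shift, with $$\operatorname{dom}\gamma_n=(\mathbb{N}\times\mathbb{N})\setminus\{(1,i):1\le i\le n\},\qquad (i,j)\gamma_n=\begin{cases}(i-1,j),& j\le n,\\ (i,j),& j>n,\end{cases}$$ $$\operatorname{dom}\upsilon_n=(\mathbb{N}\times\mathbb{N})\setminus\{(i,1):1\le i\le n\},\qquad (i,j)\upsilon_n=\begin{cases}(i,j-1),& i\le n,\\ (i,j),& i>n.\end{cases}$$ **Theorem 2.15.** The quotient monoid $\mathscr{P\!O}^{+}_\infty(\mathbb{N}^2_\leqslant)/\sigma$ is isomorphic to the free commutative monoid over a countably infinite set. More precisely, if $\mathfrak{AM}_X$ is the free commutative monoid over the countably infinite set $X=\{a_n:n\in\mathbb{N}\}\cup\{b_n:n\in\mathbb{N}\}$ of pairwise distinct generators, then there is an isomorphism of monoids $\mathscr{P\!O}^{+}_\infty(\mathbb{N}^2_\leqslant)/\sigma\to\mathfrak{AM}_X$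 that sends, for every $n\in\mathbb{N}$, the $\sigma$-class of $\gamma_n$ to $a_n$ and the $\sigma$-class of $\upsilon_n$ to $b_n$. -/

import Mathlib

namespace PartialMonotone

/-- The symmetric inverse monoid over `X`: partial bijections of `X` (that is, injective partial
selfmaps), written on the right, so that `x (α * β) = (x α) β`. -/
instance symmetricInverseMonoid (X : Type*) : Monoid (X ≃. X) where
  mul α β := α.trans β
  one := PEquiv.refl X
  mul_assoc := PEquiv.trans_assoc
  one_mul := PEquiv.refl_trans
  mul_one := PEquiv.trans_refl

theorem mul_def {X : Type*} (α β : X ≃. X) : α * β = α.trans β := rfl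

theorem one_def {X : Type*} : (1 : X ≃. X) = PEquiv.refl X := rfl

theorem mul_eq_some {X : Type*} (α β : X ≃. X) (x z : X) :
    (α * β) x = some z ↔ ∃ y, α x = some y ∧ β y = some z :=
  PEquiv.trans_eq_some α β x z

/-- The domain of a partial bijection. -/
def dom {X : Type*} (α : X ≃. X) : Set X := {x | ∃ y, α x = some y}

/-- The range of a partial bijection. -/
def ran {X : Type*} (α : X ≃. X) : Set X := {y | ∃ x, α x = some y}

/-- Monotonicity of a partial selfmap. -/
def IsMonotone {X : Type*} [LE X] (α : X ≃. X) : Prop :=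
  ∀ x y x' y' : X, α x = some x' → α y = some y' → x ≤ y → x' ≤ y'

/-- For a partial bijection, the set of points mapped into a finite set is finite. -/
theorem finite_preimage {X : Type*} (α : X ≃. X) {F : Set X} (hF : F.Finite) :
    {x | ∃ y ∈ F, α x = some y}.Finite := by
  refine (hF.biUnion (t := fun y => {x | α x = some y}) ?_).subset ?_
  · intro y _
    refine Set.Subsingleton.finite ?_
    intro a ha b hb
    exact PEquiv.inj α ha hb
  · rintro x ⟨y, hy, hxy⟩
    simp only [Set.mem_iUnion]
    exact ⟨y, hy, hxy⟩

/-- For a partial map, the image of a finite set is finite. -/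
theorem finite_image {X : Type*} (α : X ≃. X) {F : Set X} (hF : F.Finite) :
    {y | ∃ x ∈ F, α x = some y}.Finite := by
  refine (finite_preimage α.symm hF).subset ?_
  rintro y ⟨x, hx, hxy⟩
  exact ⟨x, hx, (PEquiv.eq_some_iff α).2 hxy⟩

/-- The product order on pairs of positive integers is Mathlib's order on `ℕ+ × ℕ+`.
This is the monoid of monotone injective partial selfmaps of `ℕ+ × ℕ+` with cofinite domain and
cofinite range. -/
def PO : Submonoid ((ℕ+ × ℕ+) ≃. (ℕ+ × ℕ+)) where
  carrier := {α | IsMonotone α ∧ (dom α)ᶜ.Finite ∧ (ran α)ᶜ.Finite}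
  one_mem' := by
    refine ⟨?_, ?_, ?_⟩
    · intro x y x' y' hx hy hxy
      simp only [one_def, PEquiv.refl_apply, Option.some.injEq] at hx hy
      subst hx hy
      exact hxy
    · simp [dom, one_def]
    · simp [ran, one_def]
  mul_mem' := by
    rintro α β ⟨hα, hαd, hαr⟩ ⟨hβ, hβd, hβr⟩
    refine ⟨?_, ?_, ?_⟩
    · intro x y x' y' hx hy hxy
      obtain ⟨u, hu, hu'⟩ := (mul_eq_some α β _ _).1 hx
      obtain ⟨v, hv, hv'⟩ := (mul_eq_some α β _ _).1 hy
      exact hβ _ _ _ _ hu' hv' (hα _ _ _ _ hu hv hxy)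
    · refine (hαd.union (finite_preimage α hβd)).subset ?_
      intro x hx
      by_cases h : x ∈ dom α
      · obtain ⟨y, hy⟩ := h
        refine Or.inr ⟨y, ?_, hy⟩
        rintro ⟨z, hz⟩
        exact hx ⟨z, (mul_eq_some α β _ _).2 ⟨y, hy, hz⟩⟩
      · exact Or.inl h
    · refine (hβr.union (finite_image β hαr)).subset ?_
      intro z hz
      by_cases h : z ∈ ran β
      · obtain ⟨y, hy⟩ := h
        refine Or.inr ⟨y, ?_, hy⟩
        rintro ⟨x, hx⟩
        exact hz ⟨x, (mul_eq_some α β _ _).2 ⟨y, hx, hy⟩⟩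
      · exact Or.inl h

/-- The horizontal line `{(j, n) : j ∈ ℕ+}`. -/
def H (n : ℕ+) : Set (ℕ+ × ℕ+) := {x | x.2 = n}

/-- The submonoid of orientation-preserving elements: those mapping `H 1 ∩ dom α` into `H 1`. -/
def POplus : Submonoid PO where
  carrier := {α | ∀ x y : ℕ+ × ℕ+, x ∈ H 1 → α.1 x = some y → y ∈ H 1}
  one_mem' := by
    intro x y hx hxy
    have h : some x = some y := hxy
    rw [← Option.some.inj h]
    exact hx
  mul_mem' := by
    intro α β hα hβ x z hx hxz
    obtain ⟨y, hy, hz⟩ := (mul_eq_some α.1 β.1 _ _).1 hxz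
    exact hβ y z (hα x y hx hy) hz

/-- `α σ β` if and only if `α ε = β ε` for some idempotent `ε` of `PO`. -/
def SigmaRel (α β : PO) : Prop := ∃ ε : PO, IsIdempotentElem ε ∧ α * ε = β * ε

theorem eq_of_idempotent {ε : PO} (h : IsIdempotentElem ε) {x y : ℕ+ × ℕ+}
    (hxy : ε.1 x = some y) : x = y := by
  have h1 : (ε.1 * ε.1) x = some y := by
    have : ε.1 * ε.1 = ε.1 := congrArg Subtype.val h
    rw [this, hxy]
  obtain ⟨z, hz, hz'⟩ := (mul_eq_some _ _ _ _).1 h1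
  have : z = y := Option.some.inj (hz.symm.trans hxy)
  subst this
  exact PEquiv.inj ε.1 hxy hz'

open Classical in
/-- The idempotent of `PO` that is the identity outside a finite set. -/
noncomputable def idOn (F : Set (ℕ+ × ℕ+)) (hF : F.Finite) : PO :=
  ⟨PEquiv.ofSet Fᶜ, by
    refine ⟨?_, hF.subset ?_, hF.subset ?_⟩
    · intro x y x' y' hx hy hxy
      rw [PEquiv.ofSet_eq_some_iff] at hx hy
      rw [hx.1, hy.1]
      exact hxy
    · intro x hx
      by_contra h
      exact hx ⟨x, PEquiv.ofSet_eq_some_iff.2 ⟨rfl, h⟩⟩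
    · intro x hx
      by_contra h
      exact hx ⟨x, PEquiv.ofSet_eq_some_iff.2 ⟨rfl, h⟩⟩⟩

theorem idOn_eq_some {F : Set (ℕ+ × ℕ+)} {hF : F.Finite} {x y : ℕ+ × ℕ+} :
    (idOn F hF).1 x = some y ↔ y = x ∧ x ∉ F := by
  refine PEquiv.ofSet_eq_some_iff.trans ?_
  constructor
  · rintro ⟨rfl, h⟩
    exact ⟨rfl, h⟩
  · rintro ⟨rfl, h⟩
    exact ⟨rfl, h⟩

theorem idOn_idempotent (F : Set (ℕ+ × ℕ+)) (hF : F.Finite) : IsIdempotentElem (idOn F hF) := by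
  apply Subtype.ext
  apply PEquiv.ext
  intro x
  ext y
  refine (mul_eq_some _ _ _ _).trans ?_
  constructor
  · rintro ⟨z, hz, hz'⟩
    have := (idOn_eq_some.1 hz).1
    subst this
    exact hz'
  · intro h
    have := (idOn_eq_some.1 h).1
    subst this
    exact ⟨_, h, h⟩

/-- Two elements are `σ`-related if and only if they agree outside a finite set. -/
theorem sigmaRel_iff (α β : PO) :
    SigmaRel α β ↔ {x | α.1 x ≠ β.1 x}.Finite := by
  constructor
  · rintro ⟨ε, hε, h⟩
    refine (α * ε).2.2.1.subset ?_
    rintro x hx ⟨y, hy⟩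
    apply hx
    have hy2 : (β * ε).1 x = some y := by rw [← h]; exact hy
    obtain ⟨u, hu, hu'⟩ := (mul_eq_some α.1 ε.1 _ _).1 hy
    obtain ⟨v, hv, hv'⟩ := (mul_eq_some β.1 ε.1 _ _).1 hy2
    rw [hu, hv, eq_of_idempotent hε hu', eq_of_idempotent hε hv']
  · intro h
    have hF := (finite_image α.1 h).union (finite_image β.1 h)
    refine ⟨idOn _ hF, idOn_idempotent _ hF, ?_⟩
    apply Subtype.ext
    apply PEquiv.ext
    intro x
    ext z
    refine (mul_eq_some _ _ _ _).trans (Iff.trans ?_ (mul_eq_some _ _ _ _).symm)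
    by_cases hx : α.1 x = β.1 x
    · rw [hx]
    · constructor
      · rintro ⟨y, hy, hz⟩
        exact absurd (Or.inl ⟨x, hx, hy⟩) (idOn_eq_some.1 hz).2
      · rintro ⟨y, hy, hz⟩
        exact absurd (Or.inr ⟨x, hx, hy⟩) (idOn_eq_some.1 hz).2

/-- The congruence `σ` on `PO`. -/
def sigma : Con PO where
  r := SigmaRel
  iseqv := by
    refine ⟨?_, ?_, ?_⟩
    · intro α
      exact ⟨1, IsIdempotentElem.one, rfl⟩
    · rintro α β ⟨ε, hε, h⟩
      exact ⟨ε, hε, h.symm⟩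
    · intro α β γ h h'
      rw [sigmaRel_iff] at h h' ⊢
      refine (h.union h').subset ?_
      intro x hx
      by_contra hc
      simp only [Set.mem_union, Set.mem_ofPred_eq, not_or, not_not] at hc
      exact hx (hc.1.trans hc.2)
  mul' := by
    intro α β γ δ h h'
    rw [sigmaRel_iff] at h h' ⊢
    refine (h.union (finite_preimage α.1 h')).subset ?_
    intro x hx
    by_cases hαβ : α.1 x = β.1 x
    · right
      have e1 : (α * γ).1 x = (α.1 x).bind γ.1 := rfl
      have e2 : (β * δ).1 x = (β.1 x).bind δ.1 := rfl
      simp only [Set.mem_ofPred_eq, e1, e2, ← hαβ] at hx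
      cases hy : α.1 x with
      | none => simp [hy] at hx
      | some y =>
        refine ⟨y, ?_, hy⟩
        simpa [hy] using hx
    · exact Or.inl hαβ

/-- The congruence induced by `σ` on the submonoid `POplus`. -/
def sigmaPlus : Con POplus := sigma.comap POplus.subtype (fun _ _ => rfl)

theorem add_one_ne (k : ℕ+) : k + 1 ≠ 1 := (PNat.lt_add_left 1 k).ne'

theorem sub_one_eq_iff {i k : ℕ+} (h : i ≠ 1) : i - 1 = k ↔ i = k + 1 := by
  constructor
  · rintro rfl
    exact (PNat.sub_add_of_lt (lt_of_le_of_ne one_le h.symm)).symm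
  · rintro rfl
    exact PNat.add_sub

/-- The row shift `γ_n`: its domain is the complement of `{(1, j) : j ≤ n}`; it sends `(i, j)` to
`(i - 1, j)` if `j ≤ n`, and to `(i, j)` if `n < j`. -/
def gammaMap (n : ℕ+) : (ℕ+ × ℕ+) ≃. (ℕ+ × ℕ+) where
  toFun x := if x.2 ≤ n then (if x.1 = 1 then none else some (x.1 - 1, x.2)) else some x
  invFun y := if y.2 ≤ n then some (y.1 + 1, y.2) else some y
  inv := by
    rintro ⟨i, j⟩ ⟨k, l⟩
    by_cases hj : j ≤ n <;> by_cases hl : l ≤ n <;> by_cases hi : i = 1 <;>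
      simp [hj, hl, hi, Prod.ext_iff, sub_one_eq_iff] <;> grind [add_one_ne]

/-- The column shift `υ_n`: its domain is the complement of `{(i, 1) : i ≤ n}`; it sends `(i, j)` to
`(i, j - 1)` if `i ≤ n`, and to `(i, j)` if `n < i`. -/
def upsilonMap (n : ℕ+) : (ℕ+ × ℕ+) ≃. (ℕ+ × ℕ+) where
  toFun x := if x.1 ≤ n then (if x.2 = 1 then none else some (x.1, x.2 - 1)) else some x
  invFun y := if y.1 ≤ n then some (y.1, y.2 + 1) else some y
  inv := by
    rintro ⟨i, j⟩ ⟨k, l⟩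
    by_cases hj : i ≤ n <;> by_cases hl : k ≤ n <;> by_cases hi : j = 1 <;>
      simp [hj, hl, hi, Prod.ext_iff, sub_one_eq_iff] <;> grind [add_one_ne]

theorem gammaMap_eq_some {n : ℕ+} {x y : ℕ+ × ℕ+} : gammaMap n x = some y ↔
    x.2 = y.2 ∧ ((x.2 ≤ n ∧ x.1 = y.1 + 1) ∨ (n < x.2 ∧ x.1 = y.1)) := by
  have := PEquiv.eq_some_iff (gammaMap n) (a := x) (b := y)
  rw [← this]
  change (if y.2 ≤ n then some (y.1 + 1, y.2) else some y) = some x ↔ _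
  split_ifs with h
  · simp only [Option.some.injEq, Prod.ext_iff]; grind
  · simp only [Option.some.injEq, Prod.ext_iff]; grind

theorem upsilonMap_eq_some {n : ℕ+} {x y : ℕ+ × ℕ+} : upsilonMap n x = some y ↔
    x.1 = y.1 ∧ ((x.1 ≤ n ∧ x.2 = y.2 + 1) ∨ (n < x.1 ∧ x.2 = y.2)) := by
  have := PEquiv.eq_some_iff (upsilonMap n) (a := x) (b := y)
  rw [← this]
  change (if y.1 ≤ n then some (y.1, y.2 + 1) else some y) = some x ↔ _
  split_ifs with h
  · simp only [Option.some.injEq, Prod.ext_iff]; grind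
  · simp only [Option.some.injEq, Prod.ext_iff]; grind

theorem gammaMap_mem (n : ℕ+) : gammaMap n ∈ PO := by
  refine ⟨?_, ?_, ?_⟩
  · rintro ⟨i, j⟩ ⟨k, l⟩ ⟨i', j'⟩ ⟨k', l'⟩ h h' hle
    rw [gammaMap_eq_some] at h h'
    simp only [Prod.mk_le_mk, ← PNat.coe_le_coe, ← PNat.coe_lt_coe, ← PNat.coe_inj,
      PNat.add_coe, PNat.one_coe] at h h' hle ⊢
    omega
  · refine ((Set.finite_singleton (1 : ℕ+)).prod (Set.finite_Iic n)).subset ?_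
    rintro ⟨i, j⟩ hx
    by_contra hc
    by_cases hj : j ≤ n
    · have hi : i ≠ 1 := fun hi => hc ⟨hi, hj⟩
      exact hx ⟨(i - 1, j), gammaMap_eq_some.2
        ⟨rfl, Or.inl ⟨hj, (sub_one_eq_iff hi).1 rfl⟩⟩⟩
    · exact hx ⟨(i, j), gammaMap_eq_some.2 ⟨rfl, Or.inr ⟨not_le.1 hj, rfl⟩⟩⟩
  · refine Set.finite_empty.subset ?_
    rintro ⟨i, j⟩ hx
    by_cases hj : j ≤ n
    · exact hx ⟨(i + 1, j), gammaMap_eq_some.2 ⟨rfl, Or.inl ⟨hj, rfl⟩⟩⟩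
    · exact hx ⟨(i, j), gammaMap_eq_some.2 ⟨rfl, Or.inr ⟨not_le.1 hj, rfl⟩⟩⟩

theorem upsilonMap_mem (n : ℕ+) : upsilonMap n ∈ PO := by
  refine ⟨?_, ?_, ?_⟩
  · rintro ⟨i, j⟩ ⟨k, l⟩ ⟨i', j'⟩ ⟨k', l'⟩ h h' hle
    rw [upsilonMap_eq_some] at h h'
    simp only [Prod.mk_le_mk, ← PNat.coe_le_coe, ← PNat.coe_lt_coe, ← PNat.coe_inj,
      PNat.add_coe, PNat.one_coe] at h h' hle ⊢
    omega
  · refine ((Set.finite_Iic n).prod (Set.finite_singleton (1 : ℕ+))).subset ?_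
    rintro ⟨i, j⟩ hx
    by_contra hc
    by_cases hj : i ≤ n
    · have hi : j ≠ 1 := fun hi => hc ⟨hj, hi⟩
      exact hx ⟨(i, j - 1), upsilonMap_eq_some.2
        ⟨rfl, Or.inl ⟨hj, (sub_one_eq_iff hi).1 rfl⟩⟩⟩
    · exact hx ⟨(i, j), upsilonMap_eq_some.2 ⟨rfl, Or.inr ⟨not_le.1 hj, rfl⟩⟩⟩
  · refine Set.finite_empty.subset ?_
    rintro ⟨i, j⟩ hx
    by_cases hj : i ≤ n
    · exact hx ⟨(i, j + 1), upsilonMap_eq_some.2 ⟨rfl, Or.inl ⟨hj, rfl⟩⟩⟩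
    · exact hx ⟨(i, j), upsilonMap_eq_some.2 ⟨rfl, Or.inr ⟨not_le.1 hj, rfl⟩⟩⟩

/-- The row shift `γ_n` as an element of `POplus`. -/
def gamma (n : ℕ+) : POplus :=
  ⟨⟨gammaMap n, gammaMap_mem n⟩, fun _ _ hx hxy => (gammaMap_eq_some.1 hxy).1.symm.trans hx⟩

/-- The column shift `υ_n` as an element of `POplus`. -/
def upsilon (n : ℕ+) : POplus :=
  ⟨⟨upsilonMap n, upsilonMap_mem n⟩, by
    rintro ⟨i, j⟩ ⟨k, l⟩ hx hxy
    have h := (upsilonMap_eq_some.1 hxy).2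
    change l = 1
    change j = 1 at hx
    subst hx
    rcases h with ⟨_, h⟩ | ⟨_, h⟩
    · exact absurd h.symm (add_one_ne l)
    · exact h.symm⟩

end PartialMonotone

/-!
Modulo `σ`, an element `α` of `POplus` is determined by what it does outside finite sets, and the
claim is that there it merely shifts each row to the left and each column downwards, by amounts
which do not increase along the rows (columns) and eventually vanish. The consecutive differences
of these amounts are the exponents of `γ_n` and `υ_n`.

The first step restores the symmetry between the coordinates: since the first row is preserved, the
first coordinate of the image of `x` is at least that of `x` minus a constant, whence the first
column is preserved too (`axisPreserving_of_row`). The heart of the matter is that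
`α x ≤ x` on the whole domain (`AxisPreserving.apply_le`). By monotonicity it suffices that the far
end of row `n` lands in the first `n` rows, and this follows by counting the preimages of a long
rectangle `[1, M] × [1, n]` (`AxisPreserving.exists_snd_le`).

Given `α x ≤ x`, the far end of each row is shifted into a single row which is not later;
injectivity of `α` makes the assignment of rows injective, hence the identity
(`AxisPreserving.exists_row_shift`). Every row that is really shifted pushes a further point into a
large rectangle, and the number of points missing from the domain bounds the number of such rows
(`AxisPreserving.exists_row_shift_eq_zero`). Far from both axes the image of a point `x` is then
squeezed between `x` and fixed points of its row and its column, so that `x` is fixed.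

Shifts add up under composition and characterize the class modulo `σ` (`HasShifts.mul`,
`sigmaPlus_iff`), so the exponents define an injective homomorphism on the quotient; its image
contains the generators.
-/

namespace PartialMonotone

/-! ### Monotone partial bijections that preserve both axes -/

/-- A monotone partial bijection of `ℕ+ × ℕ+` with cofinite domain and cofinite range which maps
the first row into the first row and the first column into the first column. Unlike the definition
of `POplus`, this is symmetric in the two coordinates. -/
structure AxisPreserving (α : (ℕ+ × ℕ+) ≃. (ℕ+ × ℕ+)) : Prop where
  mono : IsMonotone α
  dom_finite : (dom α)ᶜ.Finite
  ran_finite : (ran α)ᶜ.Finite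
  row : ∀ i y, α (i, 1) = some y → y.2 = 1
  col : ∀ j y, α (1, j) = some y → y.1 = 1

/-- The conjugate of a partial bijection of `ℕ+ × ℕ+` by the reflection `(i, j) ↦ (j, i)`. -/
def transpose (α : (ℕ+ × ℕ+) ≃. (ℕ+ × ℕ+)) : (ℕ+ × ℕ+) ≃. (ℕ+ × ℕ+) :=
  ((Equiv.prodComm ℕ+ ℕ+).toPEquiv.trans α).trans (Equiv.prodComm ℕ+ ℕ+).toPEquiv

theorem transpose_eq_some {α : (ℕ+ × ℕ+) ≃. (ℕ+ × ℕ+)} {x y : ℕ+ × ℕ+} :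
    transpose α x = some y ↔ α x.swap = some y.swap := by
  simp only [transpose, PEquiv.trans_eq_some, Equiv.toPEquiv_apply, Option.some.injEq,
    Equiv.prodComm_apply, exists_eq_left']
  constructor
  · rintro ⟨z, hz, rfl⟩
    simpa using hz
  · intro h
    exact ⟨_, h, by simp⟩

theorem AxisPreserving.transpose {α : (ℕ+ × ℕ+) ≃. (ℕ+ × ℕ+)} (h : AxisPreserving α) :
    AxisPreserving (transpose α) where
  mono x y x' y' hx hy hxy := by
    rw [transpose_eq_some] at hx hy
    exact Prod.swap_le_swap.1 (h.mono _ _ _ _ hx hy (Prod.swap_le_swap.2 hxy))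
  dom_finite := by
    refine (h.dom_finite.image Prod.swap).subset ?_
    intro x hx
    refine ⟨x.swap, ?_, by simp⟩
    rintro ⟨y, hy⟩
    exact hx ⟨y.swap, transpose_eq_some.2 (by simpa using hy)⟩
  ran_finite := by
    refine (h.ran_finite.image Prod.swap).subset ?_
    intro x hx
    refine ⟨x.swap, ?_, by simp⟩
    rintro ⟨y, hy⟩
    exact hx ⟨y.swap, transpose_eq_some.2 (by simpa using hy)⟩
  row i y hy := h.col i y.swap (transpose_eq_some.1 hy)
  col j y hy := h.row j y.swap (transpose_eq_some.1 hy)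

theorem exists_forall_mem_dom {α : (ℕ+ × ℕ+) ≃. (ℕ+ × ℕ+)} (h : (dom α)ᶜ.Finite) :
    ∃ K : ℕ+, ∀ i j, K ≤ i ∨ K ≤ j → ∃ y, α (i, j) = some y := by
  obtain ⟨b, hb⟩ := h.bddAbove
  refine ⟨b.1 + b.2, fun i j hij => ?_⟩
  by_contra hc
  have := hb (show (i, j) ∈ (dom α)ᶜ from hc)
  have h1 : i ≤ b.1 := this.1
  have h2 : j ≤ b.2 := this.2
  have := b.1.pos
  have := b.2.pos
  simp only [← PNat.coe_le_coe, PNat.add_coe] at *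
  omega

/-- Along the first row the first coordinate of the image is strictly increasing, which bounds it
from below; monotonicity extends the bound to the columns above. -/
theorem exists_fst_le_add {α : (ℕ+ × ℕ+) ≃. (ℕ+ × ℕ+)} (hm : IsMonotone α)
    (hd : (dom α)ᶜ.Finite) (hrow : ∀ i y, α (i, 1) = some y → y.2 = 1) :
    ∃ K : ℕ+, ∀ x y, α x = some y → x.1 ≤ y.1 + K := by
  obtain ⟨K, hK⟩ := exists_forall_mem_dom hd
  have key : ∀ m : ℕ, ∀ i : ℕ+, (i : ℕ) = K + m → ∀ y, α (i, 1) = some y → m < y.1 := by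
    intro m
    induction m with
    | zero => intro i _ y _; exact y.1.pos
    | succ m ih =>
      intro i hi y hy
      obtain ⟨i', hi'⟩ : ∃ i' : ℕ+, (i' : ℕ) = K + m := ⟨⟨K + m, by positivity⟩, rfl⟩
      obtain ⟨y', hy'⟩ := hK i' 1 (Or.inl (by rw [← PNat.coe_le_coe]; omega))
      have h1 := ih i' hi' y' hy'
      have hlt : i' < i := by rw [← PNat.coe_lt_coe]; omega
      have h2 : y' ≤ y := hm _ _ _ _ hy' hy ⟨hlt.le, le_rfl⟩
      have h3 : y'.1 ≠ y.1 := by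
        intro he
        have : y' = y := Prod.ext he ((hrow _ _ hy').trans (hrow _ _ hy).symm)
        subst this
        exact hlt.ne (congrArg Prod.fst (PEquiv.inj α hy' hy))
      have h4 : y'.1 < y.1 := lt_of_le_of_ne h2.1 h3
      rw [← PNat.coe_lt_coe] at h4
      omega
  refine ⟨K, ?_⟩
  rintro ⟨i, j⟩ y hy
  rw [← PNat.coe_le_coe, PNat.add_coe]
  by_cases hi : K ≤ i
  · obtain ⟨z, hz⟩ := hK i 1 (Or.inl hi)
    have hi' : (K : ℕ) ≤ i := hi
    have h1 := key (i - K) i (by omega) z hz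
    have h2 : (z.1 : ℕ) ≤ y.1 := (hm _ _ _ _ hz hy ⟨le_rfl, one_le⟩).1
    dsimp only
    omega
  · have hi' : (i : ℕ) < K := not_le.1 hi
    dsimp only
    omega

theorem exists_snd_le_add {α : (ℕ+ × ℕ+) ≃. (ℕ+ × ℕ+)} (h : AxisPreserving α) :
    ∃ K : ℕ+, ∀ x y, α x = some y → x.2 ≤ y.2 + K := by
  obtain ⟨K, hK⟩ := exists_fst_le_add h.transpose.mono h.transpose.dom_finite h.transpose.row
  exact ⟨K, fun x y hxy => hK x.swap y.swap (transpose_eq_some.2 (by simpa using hxy))⟩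

/-- Preserving the first row forces preserving the first column. The points mapped into the first
column form an infinite set contained in finitely many columns, so there are such points
arbitrarily high up, and everything in the first column lies below one of them. -/
theorem axisPreserving_of_row {α : (ℕ+ × ℕ+) ≃. (ℕ+ × ℕ+)} (hm : IsMonotone α)
    (hd : (dom α)ᶜ.Finite) (hr : (ran α)ᶜ.Finite)
    (hrow : ∀ i y, α (i, 1) = some y → y.2 = 1) : AxisPreserving α := by
  refine ⟨hm, hd, hr, hrow, ?_⟩
  intro j y hy
  obtain ⟨K, hK⟩ := exists_fst_le_add hm hd hrow
  have hex : ∃ x z, α x = some z ∧ z.1 = 1 ∧ j ≤ x.2 := by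
    by_contra! hc
    have hsub : {z : ℕ+ × ℕ+ | z.1 = 1} ⊆
        (ran α)ᶜ ∪ {z | ∃ x ∈ Set.Iic (1 + K, j), α x = some z} := by
      intro z hz
      by_cases hzr : z ∈ ran α
      · obtain ⟨x, hx⟩ := hzr
        refine Or.inr ⟨x, ⟨?_, (hc x z hx hz).le⟩, hx⟩
        have := hK x z hx
        rwa [show z.1 = 1 from hz] at this
      · exact Or.inl hzr
    have hfin := (hr.union (finite_image α (Set.finite_Iic (1 + K, j)))).subset hsub
    refine Set.infinite_of_injective_forall_mem (f := fun m : ℕ+ => ((1 : ℕ+), m)) ?_ ?_ hfin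
    · intro a b hab
      exact congrArg Prod.snd hab
    · intro m
      rfl
  obtain ⟨x, z, hxz, hz1, hj⟩ := hex
  have := (hm _ _ _ _ hy hxz ⟨one_le, hj⟩).1
  rw [hz1] at this
  exact le_antisymm this one_le

/-! ### The image of a point lies below the point -/

/-- A partial bijection bounds the cardinality of a finite set by that of a set containing its
preimage. -/
theorem card_le_of_forall_exists_apply {X : Type*} (α : X ≃. X) {s t : Finset X}
    (h : ∀ y ∈ t, ∃ x ∈ s, α x = some y) : t.card ≤ s.card := by
  refine Finset.card_le_card_of_forall_subsingleton (fun y x => α x = some y) h ?_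
  rintro x - y ⟨-, hy⟩ z ⟨-, hz⟩
  exact Option.some.inj (hy.symm.trans hz)

theorem card_le_of_forall_apply_mem {X : Type*} (α : X ≃. X) {s t : Finset X}
    (h : ∀ x ∈ s, ∃ y ∈ t, α x = some y) : s.card ≤ t.card :=
  card_le_of_forall_exists_apply α.symm fun x hx =>
    let ⟨y, hy, hxy⟩ := h x hx
    ⟨y, hy, (PEquiv.eq_some_iff α).2 hxy⟩

/-- Otherwise, apart from finitely many points, only the rows below the `n`-th map into the first
`n` rows. Counting the preimages of the rectangle `[1, M] × [1, n]`, for `M` large, shows that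
these rows are too few. -/
theorem AxisPreserving.exists_snd_le {α : (ℕ+ × ℕ+) ≃. (ℕ+ × ℕ+)} (h : AxisPreserving α)
    (n : ℕ+) : ∃ K : ℕ+, ∀ i y, K ≤ i → α (i, n) = some y → y.2 ≤ n := by
  obtain ⟨K, hK⟩ := exists_forall_mem_dom h.dom_finite
  obtain ⟨K₁, hK₁⟩ := exists_fst_le_add h.mono h.dom_finite h.row
  obtain ⟨K₂, hK₂⟩ := exists_snd_le_add h
  by_contra! hc
  obtain ⟨i₀, y₀, hi₀, hy₀, hn⟩ := hc K
  set c := h.ran_finite.toFinset.card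
  -- The preimage of `[1, M] × [1, n]` lies in `[1, i₀] × [1, n + K₂] ∪ [1, M + K₁] × [1, n)`, which
  -- has fewer than `M * n - c` points for this `M`.
  let M : ℕ+ := ⟨i₀ * (n + K₂) + K₁ * n + c + 1, by positivity⟩
  have hcard := card_le_of_forall_exists_apply α
    (s := (Finset.Icc 1 i₀ ×ˢ Finset.Icc 1 (n + K₂)) ∪ (Finset.Icc 1 (M + K₁) ×ˢ Finset.Ico 1 n))
    (t := (Finset.Icc 1 M ×ˢ Finset.Icc 1 n) \ h.ran_finite.toFinset) (by
      intro y hy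
      simp only [Finset.mem_sdiff, Finset.mem_product, Finset.mem_Icc, Set.Finite.mem_toFinset,
        Set.mem_compl_iff, not_not] at hy
      obtain ⟨⟨⟨-, hyM⟩, -, hyn⟩, x, hx⟩ := hy
      refine ⟨x, ?_, hx⟩
      simp only [Finset.mem_union, Finset.mem_product, Finset.mem_Icc, Finset.mem_Ico,
        one_le, true_and]
      have h1 := hK₁ x y hx
      have h2 := hK₂ x y hx
      by_cases hxi : x.1 ≤ i₀
      · exact Or.inl ⟨hxi, h2.trans (by gcongr)⟩
      · refine Or.inr ⟨h1.trans (by gcongr), ?_⟩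
        by_contra hxn
        have := (h.mono _ _ _ _ hy₀ hx ⟨(not_le.1 hxi).le, not_lt.1 hxn⟩).2
        exact absurd hyn (not_le.2 (hn.trans_le this)))
  have hunion := hcard.trans (Finset.card_union_le _ _)
  have hsdiff := Finset.le_card_sdiff h.ran_finite.toFinset (Finset.Icc 1 M ×ˢ Finset.Icc 1 n)
  have h3 := hsdiff.trans hunion
  simp only [Finset.card_product, PNat.card_Icc, PNat.card_Ico, PNat.add_coe, PNat.one_coe,
    Nat.add_sub_cancel] at h3
  obtain ⟨m, hm⟩ : ∃ m : ℕ, (n : ℕ) = m + 1 := ⟨n - 1, by have := n.pos; omega⟩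
  have hM : (M : ℕ) = i₀ * (n + K₂) + K₁ * n + c + 1 := rfl
  rw [hm] at h3 hM
  rw [tsub_le_iff_right] at h3
  simp only [Nat.add_sub_cancel] at h3
  change _ ≤ _ + c at h3
  nlinarith [K₁.pos]

theorem AxisPreserving.snd_le {α : (ℕ+ × ℕ+) ≃. (ℕ+ × ℕ+)} (h : AxisPreserving α)
    {x y : ℕ+ × ℕ+} (hxy : α x = some y) : y.2 ≤ x.2 := by
  obtain ⟨K, hK⟩ := h.exists_snd_le x.2
  obtain ⟨K', hK'⟩ := exists_forall_mem_dom h.dom_finite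
  obtain ⟨z, hz⟩ := hK' (max x.1 (max K K')) x.2 (Or.inl (by simp))
  have h1 := (h.mono _ _ _ _ hxy hz ⟨by simp, le_rfl⟩).2
  exact h1.trans (hK _ z (by simp) hz)

theorem AxisPreserving.apply_le {α : (ℕ+ × ℕ+) ≃. (ℕ+ × ℕ+)} (h : AxisPreserving α)
    {x y : ℕ+ × ℕ+} (hxy : α x = some y) : y ≤ x :=
  ⟨h.transpose.snd_le (x := x.swap) (y := y.swap) (transpose_eq_some.2 (by simpa using hxy)),
    h.snd_le hxy⟩

/-! ### Rows and columns are eventually shifted -/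

theorem exists_forall_eq_of_antitoneOn {K : ℕ+} {u : ℕ+ → ℕ}
    (hu : ∀ i j, K ≤ i → i ≤ j → u j ≤ u i) : ∃ K', K ≤ K' ∧ ∀ i, K' ≤ i → u i = u K' := by
  have hne : (u '' Set.Ici K).Nonempty := ⟨u K, K, le_refl K, rfl⟩
  obtain ⟨K', hK', he⟩ := Nat.sInf_mem hne
  refine ⟨K', hK', fun i hi => le_antisymm (hu _ _ hK' hi) ?_⟩
  rw [he]
  exact Nat.sInf_le ⟨i, le_trans hK' hi, rfl⟩

/-- Far out in a row the second coordinate of the image is constant, being nondecreasing and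
bounded. From then on the first coordinate is strictly increasing, so the nonnegative difference
between a point and its image in the first coordinate does not increase, and stabilizes. -/
theorem AxisPreserving.exists_row_shift_to_row {α : (ℕ+ × ℕ+) ≃. (ℕ+ × ℕ+)}
    (h : AxisPreserving α) (n : ℕ+) : ∃ (a : ℕ) (m K : ℕ+), m ≤ n ∧
      ∀ i i' : ℕ+, K ≤ i → (i' : ℕ) = i + a → α (i', n) = some (i, m) := by
  obtain ⟨K, hK⟩ := exists_forall_mem_dom h.dom_finite
  have hex : ∀ i, ∃ y, K ≤ i → α (i, n) = some y := fun i => by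
    by_cases hi : K ≤ i
    · exact (hK i n (Or.inl hi)).imp fun y hy _ => hy
    · exact ⟨(1, 1), fun hi' => absurd hi' hi⟩
  choose f hf using hex
  have hle : ∀ i, K ≤ i → (f i).1 ≤ i ∧ (f i).2 ≤ n := fun i hi => h.apply_le (hf i hi)
  have hmono : ∀ i j, K ≤ i → i ≤ j → f i ≤ f j := fun i j hi hij =>
    h.mono _ _ _ _ (hf i hi) (hf j (hi.trans hij)) ⟨hij, le_rfl⟩
  obtain ⟨K₁, hKK₁, hK₁⟩ := exists_forall_eq_of_antitoneOn (K := K)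
    (u := fun i => (n : ℕ) - (f i).2) (fun i j hi hij => by
      have : ((f i).2 : ℕ) ≤ (f j).2 := (hmono i j hi hij).2
      omega)
  have hsnd : ∀ i, K₁ ≤ i → (f i).2 = (f K₁).2 := by
    intro i hi
    have h1 := hK₁ i hi
    have h2 : ((f i).2 : ℕ) ≤ n := (hle i (hKK₁.trans hi)).2
    have h3 : ((f K₁).2 : ℕ) ≤ n := (hle K₁ hKK₁).2
    rw [← PNat.coe_inj]
    omega
  have hlt : ∀ i j, K₁ ≤ i → i < j → (f i).1 < (f j).1 := by
    intro i j hi hij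
    refine lt_of_le_of_ne (hmono i j (hKK₁.trans hi) hij.le).1 fun he => hij.ne ?_
    have he' : f i = f j := Prod.ext he ((hsnd i hi).trans (hsnd j (hi.trans hij.le)).symm)
    have h1 := hf i (hKK₁.trans hi)
    rw [he'] at h1
    exact congrArg Prod.fst (PEquiv.inj α h1 (hf j (hKK₁.trans (hi.trans hij.le))))
  have hadd : ∀ k : ℕ, ∀ i j : ℕ+, K₁ ≤ i → (j : ℕ) = i + k → ((f i).1 : ℕ) + k ≤ (f j).1 := by
    intro k
    induction k with
    | zero =>
      intro i j _ hj
      rw [PNat.coe_injective hj]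
      rfl
    | succ k ih =>
      intro i j hi hj
      obtain ⟨l, hl⟩ : ∃ l : ℕ+, (l : ℕ) = i + k := ⟨⟨i + k, by positivity⟩, rfl⟩
      have h1 := ih i l hi hl
      have hil : (i : ℕ) ≤ l := by omega
      have hlj : (l : ℕ) < j := by omega
      have h2 : ((f l).1 : ℕ) < (f j).1 := hlt l j (hi.trans hil) hlj
      omega
  obtain ⟨K₂, hKK₂, hK₂⟩ := exists_forall_eq_of_antitoneOn (K := K₁)
    (u := fun i => (i : ℕ) - (f i).1) (fun i j hi hij => by
      have hij' : (i : ℕ) ≤ j := hij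
      have := hadd (j - i) i j hi (by omega)
      omega)
  refine ⟨K₂ - (f K₂).1, (f K₁).2, K₂, (hle K₁ hKK₁).2, fun i i' hi hi' => ?_⟩
  have hii' : (K₂ : ℕ) ≤ i' := by
    have : (K₂ : ℕ) ≤ i := hi
    omega
  have h1 := hK₂ i' hii'
  have h2 : ((f i').1 : ℕ) ≤ i' := (hle i' (hKK₁.trans (hKK₂.trans hii'))).1
  rw [hf i' (hKK₁.trans (hKK₂.trans hii'))]
  refine congrArg some (Prod.ext ?_ (hsnd i' (hKK₂.trans hii')))
  rw [← PNat.coe_inj]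
  change ((f i').1 : ℕ) = i
  omega

/-- The assignment of a target row to each row is injective, since two shifted rows with the same
target overlap; as no row is sent to a later one, every row is sent to itself. -/
theorem AxisPreserving.exists_row_shift {α : (ℕ+ × ℕ+) ≃. (ℕ+ × ℕ+)}
    (h : AxisPreserving α) (n : ℕ+) : ∃ (a : ℕ) (K : ℕ+),
      ∀ i i' : ℕ+, K ≤ i → (i' : ℕ) = i + a → α (i', n) = some (i, n) := by
  choose a ρ K hρ hK using h.exists_row_shift_to_row
  have hinj : ∀ m n, ρ m = ρ n → m = n := by
    intro m n hmn
    let i := max (K m) (K n)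
    have h1 := hK m i ⟨i + a m, by positivity⟩ (le_max_left _ _) rfl
    have h2 := hK n i ⟨i + a n, by positivity⟩ (le_max_right _ _) rfl
    rw [hmn] at h1
    exact congrArg Prod.snd (PEquiv.inj α h1 h2)
  have hid : ∀ n, ρ n = n := by
    intro n
    induction n using PNat.strongInductionOn with
    | _ n ih =>
      by_contra hne
      exact hne (hinj _ _ (ih _ (lt_of_le_of_ne (hρ n) hne)))
  refine ⟨a n, K n, ?_⟩
  have := hK n
  rwa [hid n] at this

/-- Far out, row `j` is shifted by `r j` to the left, and far up, column `i` is shifted by `c i`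
downwards; far from both axes the map is the identity. -/
structure HasShifts (α : (ℕ+ × ℕ+) ≃. (ℕ+ × ℕ+)) (r c : ℕ+ → ℕ) : Prop where
  row : ∀ j, ∃ K : ℕ+, ∀ i i' : ℕ+, K ≤ i → (i' : ℕ) = i + r j → α (i', j) = some (i, j)
  col : ∀ i, ∃ K : ℕ+, ∀ j j' : ℕ+, K ≤ j → (j' : ℕ) = j + c i → α (i, j') = some (i, j)
  corner : ∃ K : ℕ+, ∀ i j, K ≤ i → K ≤ j → α (i, j) = some (i, j)

theorem HasShifts.transpose {α : (ℕ+ × ℕ+) ≃. (ℕ+ × ℕ+)} {r c : ℕ+ → ℕ} (h : HasShifts α r c) :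
    HasShifts (transpose α) c r where
  row j := (h.col j).imp fun _ hK i i' hi hi' => transpose_eq_some.2 (hK i i' hi hi')
  col j := (h.row j).imp fun _ hK i i' hi hi' => transpose_eq_some.2 (hK i i' hi hi')
  corner := h.corner.imp fun _ hK i j hi hj => transpose_eq_some.2 (hK j i hj hi)

theorem antitone_of_row_shift {α : (ℕ+ × ℕ+) ≃. (ℕ+ × ℕ+)} (hm : IsMonotone α) {r : ℕ+ → ℕ}
    (hr : ∀ j, ∃ K : ℕ+, ∀ i i' : ℕ+, K ≤ i → (i' : ℕ) = i + r j → α (i', j) = some (i, j)) :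
    Antitone r := by
  intro j k hjk
  obtain ⟨K, hK⟩ := hr j
  obtain ⟨L, hL⟩ := hr k
  obtain ⟨i, hi⟩ : ∃ i : ℕ+, (i : ℕ) = K + L + r j + r k :=
    ⟨⟨K + L + r j + r k, by positivity⟩, rfl⟩
  obtain ⟨p, hp⟩ : ∃ p : ℕ+, (p : ℕ) = K + L + r k :=
    ⟨⟨K + L + r k, by positivity⟩, rfl⟩
  obtain ⟨q, hq⟩ : ∃ q : ℕ+, (q : ℕ) = K + L + r j :=
    ⟨⟨K + L + r j, by positivity⟩, rfl⟩
  have h1 := hK p i (by rw [← PNat.coe_le_coe]; omega) (by omega)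
  have h2 := hL q i (by rw [← PNat.coe_le_coe]; omega) (by omega)
  have h3 : (p : ℕ) ≤ q := (hm _ _ _ _ h1 h2 ⟨le_rfl, hjk⟩).1
  omega

/-- If `r N ≠ 0`, then each of the first `N` rows is moved to the left, so that for large `M` the
rectangle `[1, M] × [1, N]` contains its own image and that of `N` further points; hence at least
`N` of its points have no image. -/
theorem AxisPreserving.exists_row_shift_eq_zero {α : (ℕ+ × ℕ+) ≃. (ℕ+ × ℕ+)}
    (h : AxisPreserving α) {r : ℕ+ → ℕ}
    (hr : ∀ j, ∃ K : ℕ+, ∀ i i' : ℕ+, K ≤ i → (i' : ℕ) = i + r j → α (i', j) = some (i, j)) :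
    ∃ N, r N = 0 := by
  by_contra! hne
  have hr' := hr
  choose K hK using hr'
  set c := h.dom_finite.toFinset.card
  obtain ⟨N, hN⟩ : ∃ N : ℕ+, (N : ℕ) = c + 1 := ⟨⟨c + 1, by positivity⟩, rfl⟩
  obtain ⟨M, hM⟩ : ∃ M : ℕ+, ∀ j ≤ N, (K j : ℕ) + r j ≤ M := by
    obtain ⟨b, hb⟩ := ((Set.finite_Iic N).image fun j => (K j : ℕ) + r j).bddAbove
    refine ⟨⟨b + 1, by positivity⟩, fun j hj => ?_⟩
    have := hb ⟨j, hj, rfl⟩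
    change _ ≤ b + 1
    dsimp only at this
    omega
  have hcard := card_le_of_forall_apply_mem α
    (s := (Finset.Icc 1 M ×ˢ Finset.Icc 1 N ∪ {M + 1} ×ˢ Finset.Icc 1 N) \ h.dom_finite.toFinset)
    (t := Finset.Icc 1 M ×ˢ Finset.Icc 1 N) (by
      rintro ⟨i, j⟩ hx
      simp only [Finset.mem_sdiff, Finset.mem_union, Finset.mem_product, Finset.mem_Icc,
        Finset.mem_singleton, one_le, true_and, Set.Finite.mem_toFinset, Set.mem_compl_iff,
        not_not] at hx ⊢
      obtain ⟨hx, y, hy⟩ := hx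
      refine ⟨y, ?_, hy⟩
      have hyx := h.apply_le hy
      rcases hx with hx | ⟨rfl, hj⟩
      · exact ⟨hyx.1.trans hx.1, hyx.2.trans hx.2⟩
      · refine ⟨?_, hyx.2.trans hj⟩
        have h1 := hM j hj
        have h2 := hne j
        have h3 := (K j).pos
        obtain ⟨i, hi⟩ : ∃ i : ℕ+, (i : ℕ) = M + 1 - r j :=
          ⟨⟨M + 1 - r j, by omega⟩, rfl⟩
        have h4 := hK j i (M + 1) (by rw [← PNat.coe_le_coe]; omega)
          (by rw [PNat.add_coe, PNat.one_coe]; omega)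
        rw [hy, Option.some.injEq] at h4
        rw [h4, ← PNat.coe_le_coe]
        dsimp only
        omega)
  have hsdiff := (Finset.le_card_sdiff h.dom_finite.toFinset
    (Finset.Icc 1 M ×ˢ Finset.Icc 1 N ∪ {M + 1} ×ˢ Finset.Icc 1 N)).trans hcard
  rw [Finset.card_union_of_disjoint] at hsdiff
  · simp only [Finset.card_product, PNat.card_Icc, PNat.one_coe, Nat.add_sub_cancel,
      Finset.card_singleton, tsub_le_iff_right] at hsdiff
    change _ ≤ _ + c at hsdiff
    omega
  · rw [Finset.disjoint_left]
    rintro ⟨i, j⟩ h1 h2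
    simp only [Finset.mem_product, Finset.mem_Icc, Finset.mem_singleton] at h1 h2
    exact absurd h1.1.2 (not_le.2 (h2.1 ▸ PNat.lt_add_right M 1))

/-- The shifts of rows and columns; far from the axes, a point lies above a fixed point of the same
row and a fixed point of the same column, and hence is fixed. -/
theorem AxisPreserving.exists_hasShifts {α : (ℕ+ × ℕ+) ≃. (ℕ+ × ℕ+)} (h : AxisPreserving α) :
    ∃ r c, HasShifts α r c := by
  choose r Kr hr using h.exists_row_shift
  choose c Kc hc using h.transpose.exists_row_shift
  obtain ⟨J, hJ⟩ := h.exists_row_shift_eq_zero fun j => ⟨Kr j, hr j⟩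
  obtain ⟨I, hI⟩ := h.transpose.exists_row_shift_eq_zero fun i => ⟨Kc i, hc i⟩
  obtain ⟨K, hK⟩ := exists_forall_mem_dom h.dom_finite
  refine ⟨r, c, fun j => ⟨Kr j, hr j⟩,
    fun i => ⟨Kc i, fun j j' hj hj' => transpose_eq_some.1 (hc i j j' hj hj')⟩,
    max (max I J) (max K (max (Kr J) (Kc I))), fun i j hi hj => ?_⟩
  simp only [max_le_iff] at hi hj
  obtain ⟨y, hy⟩ := hK i j (Or.inl hi.2.1)
  have h1 := hr J i i hi.2.2.1 (by rw [hJ, add_zero])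
  have h2 : α (I, j) = some (I, j) :=
    transpose_eq_some.1 (hc I j j hj.2.2.2 (by rw [hI, add_zero]))
  have h3 := (h.mono _ _ _ _ h1 hy ⟨le_rfl, hj.1.2⟩).1
  have h4 := (h.mono _ _ _ _ h2 hy ⟨hi.1.1, le_rfl⟩).2
  rw [hy, le_antisymm (h.apply_le hy) ⟨h3, h4⟩]

/-! ### Shifts are additive and determine the class modulo `σ` -/

theorem HasShifts.one : HasShifts 1 0 0 where
  row j := ⟨1, fun i i' _ hi => by rw [PNat.coe_injective (hi.trans (Nat.add_zero _))]; rfl⟩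
  col j := ⟨1, fun i i' _ hi => by rw [PNat.coe_injective (hi.trans (Nat.add_zero _))]; rfl⟩
  corner := ⟨1, fun _ _ _ _ => rfl⟩

theorem HasShifts.mul {α β : (ℕ+ × ℕ+) ≃. (ℕ+ × ℕ+)} {r c r' c' : ℕ+ → ℕ}
    (hα : HasShifts α r c) (hβ : HasShifts β r' c') :
    HasShifts (α * β) (r + r') (c + c') where
  row j := by
    obtain ⟨K, hK⟩ := hα.row j
    obtain ⟨L, hL⟩ := hβ.row j
    refine ⟨max K L, fun i i' hi hi' => (mul_eq_some _ _ _ _).2 ?_⟩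
    rw [max_le_iff] at hi
    obtain ⟨p, hp⟩ : ∃ p : ℕ+, (p : ℕ) = i + r' j := ⟨⟨i + r' j, by positivity⟩, rfl⟩
    have hip : (i : ℕ) ≤ p := by omega
    refine ⟨(p, j), hK p i' (hi.1.trans hip) ?_, hL i p hi.2 hp⟩
    rw [hi', hp, Pi.add_apply]
    omega
  col j := by
    obtain ⟨K, hK⟩ := hα.col j
    obtain ⟨L, hL⟩ := hβ.col j
    refine ⟨max K L, fun i i' hi hi' => (mul_eq_some _ _ _ _).2 ?_⟩
    rw [max_le_iff] at hi
    obtain ⟨p, hp⟩ : ∃ p : ℕ+, (p : ℕ) = i + c' j := ⟨⟨i + c' j, by positivity⟩, rfl⟩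
    have hip : (i : ℕ) ≤ p := by omega
    refine ⟨(j, p), hK p i' (hi.1.trans hip) ?_, hL i p hi.2 hp⟩
    rw [hi', hp, Pi.add_apply]
    omega
  corner := by
    obtain ⟨K, hK⟩ := hα.corner
    obtain ⟨L, hL⟩ := hβ.corner
    refine ⟨max K L, fun i j hi hj => (mul_eq_some _ _ _ _).2 ⟨(i, j), ?_, ?_⟩⟩
    · exact hK i j ((le_max_left _ _).trans hi) ((le_max_left _ _).trans hj)
    · exact hL i j ((le_max_right _ _).trans hi) ((le_max_right _ _).trans hj)

/-- Two maps with the same row shifts differ in only finitely many points of each row. -/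
theorem HasShifts.row_finite {α β : (ℕ+ × ℕ+) ≃. (ℕ+ × ℕ+)} {r c c' : ℕ+ → ℕ}
    (hα : HasShifts α r c) (hβ : HasShifts β r c') (j : ℕ+) :
    {x : ℕ+ × ℕ+ | α x ≠ β x ∧ x.2 = j}.Finite := by
  obtain ⟨K, hK⟩ := hα.row j
  obtain ⟨L, hL⟩ := hβ.row j
  refine (Set.finite_Iic ((⟨K + L + r j, by positivity⟩ : ℕ+), j)).subset ?_
  rintro ⟨i, j'⟩ ⟨hne, hj⟩
  obtain rfl : j = j' := hj.symm
  refine ⟨?_, le_rfl⟩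
  by_contra hc
  have hc' : (K : ℕ) + L + r j < i := not_le.1 hc
  obtain ⟨p, hp⟩ : ∃ p : ℕ+, (i : ℕ) = p + r j :=
    ⟨⟨i - r j, by omega⟩, (Nat.sub_add_cancel (by omega)).symm⟩
  have hKp : (K : ℕ) ≤ p := by omega
  have hLp : (L : ℕ) ≤ p := by omega
  exact hne ((hK p i hKp hp).trans (hL p i hLp hp).symm)

theorem HasShifts.finite_ne {α β : (ℕ+ × ℕ+) ≃. (ℕ+ × ℕ+)} {r c : ℕ+ → ℕ}
    (hα : HasShifts α r c) (hβ : HasShifts β r c) : {x | α x ≠ β x}.Finite := by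
  obtain ⟨K, hK⟩ := hα.corner
  obtain ⟨L, hL⟩ := hβ.corner
  have hrows := (Set.finite_Iio (max K L)).biUnion fun j _ => hα.row_finite hβ j
  have hcols := (Set.finite_Iio (max K L)).biUnion fun i _ =>
    (hα.transpose.row_finite hβ.transpose i).image Prod.swap
  refine (hrows.union hcols).subset ?_
  rintro ⟨i, j⟩ hne
  simp only [Set.mem_union, Set.mem_iUnion]
  by_cases hj : j < max K L
  · exact Or.inl ⟨j, hj, hne, rfl⟩
  by_cases hi : i < max K L
  · refine Or.inr ⟨i, hi, (j, i), ⟨fun he => hne ?_, rfl⟩, rfl⟩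
    ext ⟨p, q⟩
    have h1 := transpose_eq_some (α := α) (x := (j, i)) (y := (q, p))
    have h2 := transpose_eq_some (α := β) (x := (j, i)) (y := (q, p))
    rw [he] at h1
    exact h1.symm.trans h2
  · rw [not_lt, max_le_iff] at hi hj
    exact absurd ((hK i j hi.1 hj.1).trans (hL i j hi.2 hj.2).symm) hne

theorem HasShifts.row_eq_of_finite_ne {α β : (ℕ+ × ℕ+) ≃. (ℕ+ × ℕ+)} {r c r' c' : ℕ+ → ℕ}
    (hα : HasShifts α r c) (hβ : HasShifts β r' c') (h : {x | α x ≠ β x}.Finite) : r = r' := by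
  funext j
  obtain ⟨K, hK⟩ := hα.row j
  obtain ⟨L, hL⟩ := hβ.row j
  obtain ⟨b, hb⟩ := h.bddAbove
  obtain ⟨i, hi⟩ : ∃ i : ℕ+, i = K + L + b.1 := ⟨_, rfl⟩
  have hi' : (i : ℕ) = K + L + b.1 := by rw [hi, PNat.add_coe, PNat.add_coe]
  obtain ⟨p, hp⟩ : ∃ p : ℕ+, (p : ℕ) = i + r j := ⟨⟨i + r j, by positivity⟩, rfl⟩
  obtain ⟨q, hq⟩ : ∃ q : ℕ+, (q : ℕ) = i + r' j := ⟨⟨i + r' j, by positivity⟩, rfl⟩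
  have h1 := hK i p (by rw [← PNat.coe_le_coe]; omega) hp
  have h2 := hL i q (by rw [← PNat.coe_le_coe]; omega) hq
  have h3 : α (p, j) = β (p, j) := by
    by_contra hc
    have h4 : (p : ℕ) ≤ b.1 := (hb hc).1
    have := K.pos
    omega
  have h5 : (p, j) = (q, j) := PEquiv.inj β (h3.symm.trans h1) h2
  have h6 : (p : ℕ) = q := congrArg (fun x : ℕ+ × ℕ+ => (x.1 : ℕ)) h5
  omega

theorem finite_transpose_ne {α β : (ℕ+ × ℕ+) ≃. (ℕ+ × ℕ+)} (h : {x | α x ≠ β x}.Finite) :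
    {x | transpose α x ≠ transpose β x}.Finite := by
  refine (h.image Prod.swap).subset fun x hx => ⟨x.swap, fun he => hx ?_, x.swap_swap⟩
  ext y
  refine transpose_eq_some.trans (Iff.trans ?_ transpose_eq_some.symm)
  rw [he]

theorem HasShifts.eq_of_finite_ne {α β : (ℕ+ × ℕ+) ≃. (ℕ+ × ℕ+)} {r c r' c' : ℕ+ → ℕ}
    (hα : HasShifts α r c) (hβ : HasShifts β r' c') (h : {x | α x ≠ β x}.Finite) :
    r = r' ∧ c = c' :=
  ⟨hα.row_eq_of_finite_ne hβ h,
    hα.transpose.row_eq_of_finite_ne hβ.transpose (finite_transpose_ne h)⟩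

theorem HasShifts.unique {α : (ℕ+ × ℕ+) ≃. (ℕ+ × ℕ+)} {r c r' c' : ℕ+ → ℕ}
    (h : HasShifts α r c) (h' : HasShifts α r' c') : r = r' ∧ c = c' :=
  h.eq_of_finite_ne h' (by simp)

theorem HasShifts.exists_row_eq_zero {α : (ℕ+ × ℕ+) ≃. (ℕ+ × ℕ+)} {r c : ℕ+ → ℕ}
    (h : HasShifts α r c) : ∃ N, ∀ j, N ≤ j → r j = 0 := by
  obtain ⟨K, hK⟩ := h.corner
  refine ⟨K, fun j hj => ?_⟩
  obtain ⟨L, hL⟩ := h.row j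
  have h1 := hL (max K L) ⟨(max K L : ℕ+) + r j, by positivity⟩ (le_max_right _ _) rfl
  have h2 := PEquiv.inj α h1 (hK (max K L) j (le_max_left _ _) hj)
  have h3 := congrArg (fun x : ℕ+ × ℕ+ => (x.1 : ℕ)) h2
  change ((max K L : ℕ+) : ℕ) + r j = (max K L : ℕ+) at h3
  omega

theorem hasShifts_gammaMap (n : ℕ+) :
    HasShifts (gammaMap n) (fun j => if j ≤ n then 1 else 0) 0 where
  row j := by
    refine ⟨1, fun i i' _ hi => gammaMap_eq_some.2 ⟨rfl, ?_⟩⟩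
    split_ifs at hi with hj
    · exact Or.inl ⟨hj, PNat.coe_injective hi⟩
    · exact Or.inr ⟨not_le.1 hj, PNat.coe_injective hi⟩
  col i := by
    refine ⟨n + 1, fun j j' hj hj' => ?_⟩
    have he : j' = j := PNat.coe_injective hj'
    subst he
    exact gammaMap_eq_some.2 ⟨rfl, Or.inr ⟨PNat.add_one_le_iff.1 hj, rfl⟩⟩
  corner := ⟨n + 1, fun i j _ hj =>
    gammaMap_eq_some.2 ⟨rfl, Or.inr ⟨PNat.add_one_le_iff.1 hj, rfl⟩⟩⟩

theorem transpose_gammaMap (n : ℕ+) : transpose (gammaMap n) = upsilonMap n := by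
  ext x y
  refine transpose_eq_some.trans (gammaMap_eq_some.trans upsilonMap_eq_some.symm)

theorem hasShifts_upsilonMap (n : ℕ+) :
    HasShifts (upsilonMap n) 0 (fun i => if i ≤ n then 1 else 0) :=
  transpose_gammaMap n ▸ (hasShifts_gammaMap n).transpose

/-! ### The isomorphism -/

theorem axisPreserving (α : POplus) : AxisPreserving α.1.1 :=
  axisPreserving_of_row α.1.2.1 α.1.2.2.1 α.1.2.2.2 fun i y hy => α.2 (i, 1) y rfl hy

/-- The amounts by which the rows of an element of `POplus` are eventually shifted. -/
noncomputable def rowShift (α : POplus) : ℕ+ → ℕ :=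
  (axisPreserving α).exists_hasShifts.choose

/-- The amounts by which the columns of an element of `POplus` are eventually shifted. -/
noncomputable def colShift (α : POplus) : ℕ+ → ℕ :=
  (axisPreserving α).exists_hasShifts.choose_spec.choose

theorem hasShifts (α : POplus) : HasShifts α.1.1 (rowShift α) (colShift α) :=
  (axisPreserving α).exists_hasShifts.choose_spec.choose_spec

theorem rowShift_antitone (α : POplus) : Antitone (rowShift α) :=
  antitone_of_row_shift α.1.2.1 (hasShifts α).row

theorem colShift_antitone (α : POplus) : Antitone (colShift α) :=
  antitone_of_row_shift (axisPreserving α).transpose.mono (hasShifts α).transpose.row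

theorem rowShift_mul (α β : POplus) : rowShift (α * β) = rowShift α + rowShift β :=
  ((hasShifts (α * β)).unique ((hasShifts α).mul (hasShifts β))).1

theorem colShift_mul (α β : POplus) : colShift (α * β) = colShift α + colShift β :=
  ((hasShifts (α * β)).unique ((hasShifts α).mul (hasShifts β))).2

theorem rowShift_one : rowShift 1 = 0 := ((hasShifts 1).unique HasShifts.one).1

theorem colShift_one : colShift 1 = 0 := ((hasShifts 1).unique HasShifts.one).2

theorem sigmaPlus_iff (α β : POplus) :
    sigmaPlus α β ↔ rowShift α = rowShift β ∧ colShift α = colShift β := by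
  refine Iff.trans (sigmaRel_iff α.1 β.1) ⟨(hasShifts α).eq_of_finite_ne (hasShifts β), ?_⟩
  rintro ⟨h1, h2⟩
  have h := hasShifts α
  rw [h1, h2] at h
  exact h.finite_ne (hasShifts β)

/-- The consecutive differences of a sequence; subtraction is truncated, which is harmless for the
nonincreasing sequences to which this is applied. -/
def drop (r : ℕ+ → ℕ) (n : ℕ+) : ℕ := r n - r (n + 1)

theorem drop_zero : drop 0 = 0 := rfl

theorem drop_add {r s : ℕ+ → ℕ} (hr : Antitone r) (hs : Antitone s) :
    drop (r + s) = drop r + drop s := by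
  funext n
  have h1 := hr (PNat.lt_add_right n 1).le
  have h2 := hs (PNat.lt_add_right n 1).le
  simp only [drop, Pi.add_apply]
  omega

theorem drop_ite (n : ℕ+) : drop (fun j => if j ≤ n then 1 else 0) = Pi.single n 1 := by
  funext m
  simp only [drop, Pi.single_apply, ← PNat.coe_le_coe, ← PNat.coe_inj, PNat.add_coe, PNat.one_coe]
  split_ifs <;> omega

theorem drop_injective {r s : ℕ+ → ℕ} (hr : Antitone r) (hs : Antitone s)
    (hr0 : ∃ N, ∀ j, N ≤ j → r j = 0) (hs0 : ∃ N, ∀ j, N ≤ j → s j = 0)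
    (h : drop r = drop s) : r = s := by
  obtain ⟨N, hN⟩ := hr0
  obtain ⟨M, hM⟩ := hs0
  -- Descending induction from an index beyond which both sequences vanish.
  have key : ∀ k : ℕ, ∀ n : ℕ+, (N : ℕ) + M ≤ n + k → r n = s n := by
    intro k
    induction k with
    | zero =>
      intro n hn
      rw [hN n (by rw [← PNat.coe_le_coe]; omega), hM n (by rw [← PNat.coe_le_coe]; omega)]
    | succ k ih =>
      intro n hn
      have h1 := ih (n + 1) (by rw [PNat.add_coe, PNat.one_coe]; omega)
      have h2 := congrFun h n
      have h3 := hr (PNat.lt_add_right n 1).le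
      have h4 := hs (PNat.lt_add_right n 1).le
      simp only [drop] at h2
      omega
  exact funext fun n => key (N + M) n (by omega)

theorem drop_support_finite {r : ℕ+ → ℕ} (h : ∃ N, ∀ j, N ≤ j → r j = 0) :
    {n | drop r n ≠ 0}.Finite := by
  obtain ⟨N, hN⟩ := h
  refine (Set.finite_Iio N).subset fun n hn => ?_
  by_contra hc
  exact hn (by rw [drop, hN n (not_lt.1 hc), Nat.zero_sub])

theorem rowShift_exists_zero (α : POplus) : ∃ N, ∀ j, N ≤ j → rowShift α j = 0 :=
  (hasShifts α).exists_row_eq_zero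

theorem colShift_exists_zero (α : POplus) : ∃ N, ∀ j, N ≤ j → colShift α j = 0 :=
  (hasShifts α).transpose.exists_row_eq_zero

/-- The exponents of the class of an element of `POplus`: that of the `n`-th row generator is the
difference of the shifts of rows `n` and `n + 1`, and similarly for columns. -/
noncomputable def exponents (α : POplus) : (ℕ+ ⊕ ℕ+) →₀ ℕ :=
  Finsupp.ofSupportFinite (Sum.elim (drop (rowShift α)) (drop (colShift α))) (by
    refine (((drop_support_finite (rowShift_exists_zero α)).image Sum.inl).union
      ((drop_support_finite (colShift_exists_zero α)).image Sum.inr)).subset ?_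
    rintro (n | n) hn
    · exact Or.inl ⟨n, hn, rfl⟩
    · exact Or.inr ⟨n, hn, rfl⟩)

theorem exponents_inl (α : POplus) (n : ℕ+) : exponents α (Sum.inl n) = drop (rowShift α) n := rfl

theorem exponents_inr (α : POplus) (n : ℕ+) : exponents α (Sum.inr n) = drop (colShift α) n := rfl

/-- The exponents as a homomorphism to the free commutative monoid. -/
noncomputable def exponentsHom : POplus →* Multiplicative ((ℕ+ ⊕ ℕ+) →₀ ℕ) where
  toFun α := Multiplicative.ofAdd (exponents α)
  map_one' := by
    rw [← ofAdd_zero]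
    congr 1
    ext (n | n)
    · rw [exponents_inl, rowShift_one, drop_zero]; rfl
    · rw [exponents_inr, colShift_one, drop_zero]; rfl
  map_mul' α β := by
    rw [← ofAdd_add]
    congr 1
    ext (n | n)
    · rw [exponents_inl, rowShift_mul, drop_add (rowShift_antitone α) (rowShift_antitone β)]
      rfl
    · rw [exponents_inr, colShift_mul, drop_add (colShift_antitone α) (colShift_antitone β)]
      rfl

theorem exponents_eq_iff (α β : POplus) : exponents α = exponents β ↔ sigmaPlus α β := by
  rw [sigmaPlus_iff]
  constructor
  · intro h
    refine ⟨drop_injective (rowShift_antitone α) (rowShift_antitone β) (rowShift_exists_zero α)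
      (rowShift_exists_zero β) (funext fun n => ?_), drop_injective (colShift_antitone α)
      (colShift_antitone β) (colShift_exists_zero α) (colShift_exists_zero β)
      (funext fun n => ?_)⟩
    · exact DFunLike.congr_fun h (Sum.inl n)
    · exact DFunLike.congr_fun h (Sum.inr n)
  · rintro ⟨h1, h2⟩
    ext (n | n)
    · rw [exponents_inl, exponents_inl, h1]
    · rw [exponents_inr, exponents_inr, h2]

theorem exponents_gamma (n : ℕ+) : exponents (gamma n) = Finsupp.single (Sum.inl n) 1 := by
  obtain ⟨h1, h2⟩ := (hasShifts (gamma n)).unique (hasShifts_gammaMap n)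
  ext (m | m)
  · rw [exponents_inl, h1, drop_ite]
    simp [Pi.single_apply, Finsupp.single_apply, eq_comm]
  · rw [exponents_inr, h2, drop_zero]
    simp

theorem exponents_upsilon (n : ℕ+) : exponents (upsilon n) = Finsupp.single (Sum.inr n) 1 := by
  obtain ⟨h1, h2⟩ := (hasShifts (upsilon n)).unique (hasShifts_upsilonMap n)
  ext (m | m)
  · rw [exponents_inl, h1, drop_zero]
    simp
  · rw [exponents_inr, h2, drop_ite]
    simp [Pi.single_apply, Finsupp.single_apply, eq_comm]

theorem exponentsHom_surjective : Function.Surjective exponentsHom := by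
  suffices h : ∀ e : (ℕ+ ⊕ ℕ+) →₀ ℕ, ∃ α, exponentsHom α = Multiplicative.ofAdd e from
    fun e => h e.toAdd
  intro e
  induction e using Finsupp.induction_linear with
  | zero => exact ⟨1, map_one _⟩
  | add e f he hf =>
    obtain ⟨α, hα⟩ := he
    obtain ⟨β, hβ⟩ := hf
    exact ⟨α * β, by rw [map_mul, hα, hβ, ofAdd_add]⟩
  | single x k =>
    obtain ⟨α, hα⟩ : ∃ α, exponents α = Finsupp.single x 1 := by
      rcases x with n | n
      · exact ⟨gamma n, exponents_gamma n⟩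
      · exact ⟨upsilon n, exponents_upsilon n⟩
    refine ⟨α ^ k, ?_⟩
    rw [map_pow]
    change Multiplicative.ofAdd (exponents α) ^ k = _
    rw [hα, ← ofAdd_nsmul, Finsupp.smul_single, smul_eq_mul, mul_one]

end PartialMonotone

theorem theorem2p15 :
    ∃ φ : PartialMonotone.sigmaPlus.Quotient ≃* Multiplicative ((ℕ+ ⊕ ℕ+) →₀ ℕ),
      (∀ n : ℕ+, φ (PartialMonotone.gamma n : PartialMonotone.sigmaPlus.Quotient) =
        Multiplicative.ofAdd (Finsupp.single (Sum.inl n) 1)) ∧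
      (∀ n : ℕ+, φ (PartialMonotone.upsilon n : PartialMonotone.sigmaPlus.Quotient) =
        Multiplicative.ofAdd (Finsupp.single (Sum.inr n) 1)) := by
  open PartialMonotone in
  let ψ := sigmaPlus.lift exponentsHom fun α β h =>
    congrArg Multiplicative.ofAdd ((exponents_eq_iff α β).2 h)
  have hψ : Function.Bijective ψ := by
    constructor
    · intro p q
      induction p, q using Con.induction_on₂ with
      | _ α β => exact fun h => (Con.eq _).2 ((exponents_eq_iff α β).1 h)
    · intro e
      obtain ⟨α, hα⟩ := exponentsHom_surjective e
      exact ⟨(α : sigmaPlus.Quotient), hα⟩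
  exact ⟨MulEquiv.ofBijective ψ hψ, fun n => congrArg Multiplicative.ofAdd (exponents_gamma n),
    fun n => congrArg Multiplicative.ofAdd (exponents_upsilon n)⟩
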